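/- Let $\mathbb{F}_q$ be a finite field, let $1\le \ell<m$ be integers, let $V$ be an $m$-dimensional vector space over $\mathbb{F}_q$, and identify $\bigwedge^m V$ with $\mathbb{F}_q$ by means of a fixed basis of $V$. Let $A_1\subset\cdots\subset A_\ell$ be a strictly increasing chain of nonzero subspaces of $V$, let $\alpha_i:=\dim A_i$ and $\alpha:=(\alpha_1,\dots,\alpha_\ell)$, and let $$\Omega_\alpha(\ell,m)=\{L\subseteq V \text{ a subspace}: \dim L=\ell \text{ and } \dim(L\cap A_i)\ge i \text{ for } i=1,\dots,\ell\}$$ be the associated Schubert variety. For $f\in\bigwedge^dV$ put $V_f:=\{x\in V: f\wedge x=0\}$; $f$ is called decomposable if $f\neq 0$ and $f=f_1\wedge\cdots\wedge f_d$ for some $f_1,\dots,f_d\in V$. Let $L_1,\dots,L_n$ be an enumeration, without repetition, of all elements of $\Omega_\alpha(\ell,m)$, and for each $j$ let $P_j\in\bigwedge^\ell V$ be a nonzero element of the form $v_\ell\wedge\cdots\wedge v_1$ with $v_i\in A_i$ for all $i$ and $V_{P_j}=L_j$. For $f\in\bigwedge^{m-\ell}V$ put $c_f:=(f\wedge P_1,\dots,f\wedge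 P_n)\in\mathbb{F}_q^n$. The Schubert code is $C_\alpha(\ell,m):=\{c_f: f\in\bigwedge^{m-\ell}V\}$. Its minimum distance is the least Hamming weight of a nonzero codeword, and a codeword whose Hamming weight equals the minimum distance is called a minimum weight codeword. An integer $p$ with $1\le p<\ell$ is called a jump spot of $\alpha$ if $\alpha_{p+1}-\alpha_p\ge 2$. **Theorem 5.5.** Let $f\in\bigwedge^{m-\ell}V$ be decomposable. If $c_f$ is a minimum weight codeword of $C_\alpha(\ell,m)$, then $f$ is Schubert decomposable, i.e., $f$ is decomposable and $$\dim(V_f\cap A_p)=\alpha_p-p\quad\text{for every jump spot } p \text{ of } \alpha.$$ -/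

import Mathlib

noncomputable section

namespace SchubertCode

open Module

section ExteriorPowers

variable {K V : Type*} [Field K] [AddCommGroup V] [Module K V]

/-- The exterior product `f ∧ g` of `f ∈ ⋀^p V` and `g ∈ ⋀^r V`, as an element of `⋀^s V`, where
`p + r = s`, linear in each argument. -/
def wedge {p r s : ℕ} (h : p + r = s) : ⋀[K]^p V →ₗ[K] ⋀[K]^r V →ₗ[K] ⋀[K]^s V :=
  LinearMap.mk₂ K
    (fun f g => ⟨(f : ExteriorAlgebra K V) * (g : ExteriorAlgebra K V),
      h ▸ SetLike.mul_mem_graded f.2 g.2⟩)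
    (fun _ _ _ => Subtype.ext (add_mul _ _ _))
    (fun _ _ _ => Subtype.ext (smul_mul_assoc _ _ _))
    (fun _ _ _ => Subtype.ext (mul_add _ _ _))
    (fun _ _ _ => Subtype.ext (mul_smul_comm _ _ _))

/-- `f ∈ ⋀^d V` is decomposable: `f ≠ 0` and `f = f₁ ∧ ⋯ ∧ f_d` for some vectors `f₁, …, f_d`. -/
def IsDecomposable {d : ℕ} (f : ⋀[K]^d V) : Prop :=
  f ≠ 0 ∧ ∃ v : Fin d → V, f = exteriorPower.ιMulti K d v

/-- The annihilator `V_f = {x ∈ V : f ∧ x = 0}` of `f ∈ ⋀^d V`. -/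
def annihilator {d : ℕ} (f : ⋀[K]^d V) : Submodule K V :=
  LinearMap.ker
    ((LinearMap.mulLeft K (f : ExteriorAlgebra K V)).comp (ExteriorAlgebra.ι K))

/-- The identification of `⋀^m V` with the base field given by a basis `b` of the
`m`-dimensional space `V`: the linear map `x₁ ∧ ⋯ ∧ x_m ↦ det_b (x₁, …, x_m)`, which sends
`b₁ ∧ ⋯ ∧ b_m` to `1`. -/
def topIdent {m : ℕ} (b : Basis (Fin m) K V) : ⋀[K]^m V →ₗ[K] K :=
  exteriorPower.alternatingMapLinearEquiv b.det

end ExteriorPowers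

section Flags

variable {K V : Type*} [Field K] [AddCommGroup V] [Module K V] {l : ℕ}

/-- The dimension sequence `α = (α₁, …, α_l)` of the flag `A₁ ⊂ ⋯ ⊂ A_l`. The index `i : Fin l`
stands for the position `i + 1`, here and below. -/
def dimSeq (A : Fin l → Submodule K V) (i : Fin l) : ℕ := finrank K (A i)

/-- The Schubert variety `Ω_α(l, m)` of the flag: all `l`-dimensional subspaces `L` of `V` with
`dim (L ∩ A_i) ≥ i` for `i = 1, …, l`. -/
def schubertVariety (A : Fin l → Submodule K V) : Set (Submodule K V) :=
  {L | finrank K L = l ∧ ∀ i : Fin l, (i : ℕ) + 1 ≤ finrank K ↥(L ⊓ A i)}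

/-- `p` is a jump spot of `α`: the block of consecutive entries ending at position `p` is not the
last one, that is `1 ≤ p < l` and `α_{p+1} - α_p ≥ 2`. The index `i : Fin l` stands for
`p = i + 1`. -/
def IsJumpSpot (α : Fin l → ℕ) (i : Fin l) : Prop :=
  ∃ h : (i : ℕ) + 1 < l, α i + 2 ≤ α ⟨(i : ℕ) + 1, h⟩

/-- `f ∈ ⋀^d V` (with `d = m - l`) is Schubert decomposable with respect to the flag: it is
decomposable and `dim (V_f ∩ A_p) = α_p - p` for all jump spots `p` of `α`. -/
def IsSchubertDecomposable (A : Fin l → Submodule K V) {d : ℕ} (f : ⋀[K]^d V) : Prop :=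
  IsDecomposable f ∧
    ∀ i : Fin l, IsJumpSpot (dimSeq A) i →
      finrank K ↥(annihilator f ⊓ A i) + ((i : ℕ) + 1) = dimSeq A i

/-- `P ∈ ⋀^l V` represents the point `L` of the Schubert variety: `P` is a nonzero element of the
form `v_l ∧ ⋯ ∧ v₁` with `v_i ∈ A_i` for all `i`, and `L = V_P`. -/
def IsRepresentative (A : Fin l → Submodule K V) (L : Submodule K V) (P : ⋀[K]^l V) : Prop :=
  P ≠ 0 ∧
    (∃ v : Fin l → V, (∀ i, v i ∈ A i) ∧ P = exteriorPower.ιMulti K l (fun i => v i.rev)) ∧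
    annihilator P = L

end Flags

section Codes

variable {K : Type*} [Field K] {n : ℕ}

open Classical in
/-- The Hamming weight of `c ∈ K^n`: the number of nonzero coordinates. -/
def weight (c : Fin n → K) : ℕ := hammingNorm c

/-- The minimum distance `d(C) = min {wt(c) : c ∈ C, c ≠ 0}` of a nonzero linear code `C`. -/
def minDistance (C : Submodule K (Fin n → K)) : ℕ :=
  sInf {w | ∃ c ∈ C, c ≠ 0 ∧ weight c = w}

/-- `c` is a minimum weight codeword of `C`. -/
def IsMinWeightCodeword (C : Submodule K (Fin n → K)) (c : Fin n → K) : Prop :=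
  c ∈ C ∧ weight c = minDistance C

variable {V : Type*} [AddCommGroup V] [Module K V] {l m : ℕ}

/-- The evaluation map `⋀^{m-l} V → K^n`, `f ↦ c_f = (f ∧ P₁, …, f ∧ P_n)`, where `⋀^m V` is
identified with `K` through the basis `b`. -/
def codeword (b : Basis (Fin m) K V) (h : l ≤ m) (P : Fin n → ⋀[K]^l V) :
    ⋀[K]^(m - l) V →ₗ[K] (Fin n → K) :=
  LinearMap.pi fun j =>
    (topIdent b).comp ((wedge (Nat.sub_add_cancel h)).flip (P j))

/-- The Schubert code: the image of the evaluation map, where `P₁, …, P_n` represent the points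
of the Schubert variety. -/
def schubertCode (b : Basis (Fin m) K V) (h : l ≤ m) (P : Fin n → ⋀[K]^l V) :
    Submodule K (Fin n → K) :=
  LinearMap.range (codeword b h P)

end Codes

end SchubertCode

end

namespace SchubertCode

open Module

/-! ### Independent families adapted to a chain, and sections with prescribed values -/

section LinearAlgebra

variable {K U : Type*} [Field K] [AddCommGroup U] [Module K U]

/-! Put `W = V_f`, of dimension `m - l`, let `π : V → V/W` be the projection and `q = |K|`. For
decomposable `f` the coordinate of `c_f` at `L` is nonzero exactly when `L ∩ W = 0`, that is, when
`L` is the image of a linear section of `π`. So the weight of `c_f` counts the sections `s` with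
`dim s⁻¹(A_i) ≥ i` for all `i`. Let `N = q ^ ∑ (α_i - i)`.

Upper bound: for a projection to `K^l` that maps each `A_i` onto the first `i` coordinates there are
at most `N` such sections (`card_sections_le`). Being positive as well, this count bounds the
minimum distance by `N`.

Lower bound: if `dim π(A_i) ≥ i` for all `i`, there are at least `N` such sections, and more than
`N` if `dim π(A_p) > p` at some jump spot `p` (`pow_le_card_sections`). The induction shrinks the
space of values by hyperplanes and drops the last incidence condition once it holds automatically. A
jump at `p` guarantees a hyperplane step while `A_p` is the last member of the chain, and that step
gains strictly.

A minimum weight word has positive weight, so some section exists and `dim π(A_i) ≥ i`. Its weight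
is at most `N`, which forces `dim π(A_p) = p` at each jump spot, and rank-nullity on `A_p`
concludes. -/

theorem exists_linearIndependent_forall_mem [FiniteDimensional K U] :
    ∀ {n : ℕ} (G : Fin n → Submodule K U), (∀ i : Fin n, (i : ℕ) + 1 ≤ finrank K (G i)) →
      ∃ u : Fin n → U, LinearIndependent K u ∧ ∀ i, u i ∈ G i
  | 0, _, _ => ⟨Fin.elim0, linearIndependent_empty_type, fun i => i.elim0⟩
  | n + 1, G, hG => by
    obtain ⟨u, hu, huG⟩ := exists_linearIndependent_forall_mem (fun i : Fin n => G i.castSucc)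
      (fun i => by simpa using hG i.castSucc)
    -- Greedy choice: the last subspace has dimension at least `n + 1`, too large for the span of
    -- the `n` vectors already chosen.
    have hlt : ¬ G (Fin.last n) ≤ Submodule.span K (Set.range u) := fun h => by
      have h1 := Submodule.finrank_mono h
      have h2 := hG (Fin.last n)
      rw [finrank_span_eq_card hu, Fintype.card_fin] at h1
      simp only [Fin.val_last] at h2
      omega
    obtain ⟨x, hx, hxu⟩ := SetLike.not_le_iff_exists.1 hlt
    refine ⟨Fin.snoc (α := fun _ => U) u x, linearIndependent_finSnoc.2 ⟨hu, hxu⟩, fun i => ?_⟩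
    refine Fin.lastCases ?_ (fun j => ?_) i
    · simpa using hx
    · simpa using huG j

theorem le_finrank_of_linearIndependent_mem [FiniteDimensional K U] {n i : ℕ} {u : Fin n → U}
    (hu : LinearIndependent K u) (hi : i ≤ n) {M : Submodule K U}
    (hM : ∀ j : Fin n, (j : ℕ) < i → u j ∈ M) : i ≤ finrank K M := by
  have h1 : LinearIndependent K fun j : Fin i => u (Fin.castLE hi j) :=
    hu.comp _ (Fin.castLE_injective hi)
  have h2 : Submodule.span K (Set.range fun j : Fin i => u (Fin.castLE hi j)) ≤ M := by
    rw [Submodule.span_le]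
    rintro _ ⟨j, rfl⟩
    exact hM _ j.2
  have h3 := Submodule.finrank_mono h2
  rwa [finrank_span_eq_card h1, Fintype.card_fin] at h3

/-- A subspace of dimension `r` whose intersections with the members of a chain are large. -/
theorem exists_finrank_eq_forall_le_finrank_inf [FiniteDimensional K U] {r : ℕ}
    (G : ℕ → Submodule K U) (hmono : ∀ i j, i ≤ j → j ≤ r → G i ≤ G j)
    (hG : ∀ i ≤ r, i ≤ finrank K (G i)) :
    ∃ M : Submodule K U, M ≤ G r ∧ finrank K M = r ∧ ∀ i ≤ r, i ≤ finrank K ↥(M ⊓ G i) := by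
  obtain ⟨u, hu, huG⟩ := exists_linearIndependent_forall_mem
    (fun i : Fin r => G (i + 1)) (fun i => hG _ i.2)
  refine ⟨Submodule.span K (Set.range u), ?_, ?_, fun i hi => ?_⟩
  · rw [Submodule.span_le]
    rintro _ ⟨j, rfl⟩
    exact hmono _ _ j.2 le_rfl (huG j)
  · rw [finrank_span_eq_card hu, Fintype.card_fin]
  · exact le_finrank_of_linearIndependent_mem hu hi fun j hj =>
      ⟨Submodule.subset_span ⟨j, rfl⟩, hmono _ _ hj hi (huG j)⟩

variable {V : Type*} [AddCommGroup V] [Module K V]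

/-- A linear section of `π` with values in `X` and prescribed values on an independent family. -/
theorem exists_section_apply_eq (π : V →ₗ[K] U) {X : Submodule K V} (hX : X.map π = ⊤)
    {n : ℕ} {u : Fin n → U} (hu : LinearIndependent K u) {a : Fin n → V} (ha : ∀ i, a i ∈ X)
    (hπ : ∀ i, π (a i) = u i) :
    ∃ s : U →ₗ[K] V, (∀ x, s x ∈ X) ∧ π ∘ₗ s = LinearMap.id ∧ ∀ i, s (u i) = a i := by
  classical
  have hlift : ∀ x : U, ∃ y ∈ X, π y = x ∧ ∀ i, u i = x → y = a i := fun x => by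
    by_cases h : ∃ i, u i = x
    · obtain ⟨i, rfl⟩ := h
      exact ⟨a i, ha i, hπ i, fun j hj => by rw [hu.injective hj]⟩
    · have hx : x ∈ X.map π := hX ▸ Submodule.mem_top
      obtain ⟨y, hy, hyx⟩ := hx
      exact ⟨y, hy, hyx, fun i hi => (h ⟨i, hi⟩).elim⟩
  choose g hgX hgπ hga using hlift
  have hr := hu.linearIndepOn_id
  let B := Basis.extend hr
  have hB : ∀ j, B.constr K (fun j => g (B j)) (B j) = g (B j) := fun j => by
    rw [Basis.constr_basis]
  refine ⟨B.constr K fun j => g (B j), fun x => ?_, B.ext fun j => ?_, fun i => ?_⟩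
  · have : (⊤ : Submodule K U) ≤ X.comap (B.constr K fun j => g (B j)) := by
      rw [← B.span_eq, Submodule.span_le]
      rintro _ ⟨j, rfl⟩
      change _ ∈ X
      rw [hB]
      exact hgX _
    exact this Submodule.mem_top
  · rw [LinearMap.comp_apply, hB, hgπ, LinearMap.id_apply]
  · have hi : u i ∈ hr.extend (Set.subset_univ _) :=
      hr.subset_extend _ ⟨i, rfl⟩
    have h := hB ⟨u i, hi⟩
    have hBi : B ⟨u i, hi⟩ = u i := Basis.extend_apply_self hr _
    rw [hBi] at h
    rw [h]
    exact hga _ i rfl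

theorem finrank_inf_ker_add_finrank_map [FiniteDimensional K V] (π : V →ₗ[K] U)
    (X : Submodule K V) :
    finrank K ↥(LinearMap.ker π ⊓ X) + finrank K (X.map π) = finrank K X := by
  have h1 := LinearMap.finrank_range_add_finrank_ker (π.domRestrict X)
  rw [LinearMap.range_domRestrict] at h1
  have h3 : finrank K (LinearMap.ker (π.domRestrict X)) = finrank K ↥(LinearMap.ker π ⊓ X) := by
    rw [LinearMap.ker_domRestrict, inf_comm, ← Submodule.map_comap_subtype]
    exact (Submodule.equivSubtypeMap X _).finrank_eq
  omega

theorem finrank_inf_ker_add_one [FiniteDimensional K V] {X : Submodule K V} {φ : V →ₗ[K] K} {w : V}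
    (hw : w ∈ X) (hφ : φ w = 1) : finrank K ↥(X ⊓ LinearMap.ker φ) + 1 = finrank K X := by
  have h : X.map φ = ⊤ := by
    rw [eq_top_iff]
    rintro c -
    exact ⟨c • w, X.smul_mem c hw, by simp [hφ]⟩
  rw [← finrank_inf_ker_add_finrank_map φ X, h, finrank_top, finrank_self, inf_comm]

theorem finrank_comap_eq_finrank_inf_range [FiniteDimensional K V] {s : U →ₗ[K] V}
    (hs : Function.Injective s) (X : Submodule K V) :
    finrank K (X.comap s) = finrank K ↥(LinearMap.range s ⊓ X) := by
  rw [(Submodule.equivMapOfInjective s hs _).finrank_eq, Submodule.map_comap_eq]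

end LinearAlgebra

/-! ### Counting sections compatible with a flag: the lower bound -/

section Sections

variable {K U V : Type*} [Field K] [AddCommGroup U] [Module K U] [AddCommGroup V] [Module K V]

/-- The linear sections of `π` with values in `X` whose image meets `A i` in dimension at least `i`
for all `i ≤ r`. -/
def sections (π : V →ₗ[K] U) (A : ℕ → Submodule K V) (r : ℕ) (X : Submodule K V) :
    Set (U →ₗ[K] V) :=
  {s | (∀ u, s u ∈ X) ∧ π ∘ₗ s = LinearMap.id ∧ ∀ i ≤ r, i ≤ finrank K ((A i).comap s)}

theorem injective_of_comp_eq_id {π : V →ₗ[K] U} {s : U →ₗ[K] V} (h : π ∘ₗ s = LinearMap.id) :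
    Function.Injective s :=
  Function.LeftInverse.injective (g := π) fun u => LinearMap.congr_fun h u

/-- Since `π w = 0`, adding `θ ⊗ w` keeps a section a section; since `θ` vanishes on `M`, both maps
agree there, and `M` still witnesses every incidence condition. -/
theorem add_smulRight_mem_sections [FiniteDimensional K U] {π : V →ₗ[K] U}
    {A : ℕ → Submodule K V} {r : ℕ} {X Y : Submodule K V} (hYX : Y ≤ X) {s : U →ₗ[K] V}
    (hs : s ∈ sections π A r Y) {w : V} (hw : w ∈ X) (hπ : π w = 0) {θ : Dual K U}
    {M : Submodule K U} (hθ : ∀ x ∈ M, θ x = 0)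
    (hM : ∀ i ≤ r, i ≤ finrank K ↥(M ⊓ (A i).comap s)) :
    s + θ.smulRight w ∈ sections π A r X := by
  obtain ⟨h1, h2, -⟩ := hs
  refine ⟨fun u => X.add_mem (hYX (h1 u)) (X.smul_mem _ hw), ?_, fun i hi => (hM i hi).trans ?_⟩
  · rw [LinearMap.comp_add, h2]
    ext u
    simp [hπ]
  · refine Submodule.finrank_mono fun x hx => ?_
    have := hθ x hx.1
    simpa [this] using hx.2

theorem add_smulRight_inj {φ : V →ₗ[K] K} {w : V} (hφw : φ w = 1) {s s' : U →ₗ[K] V}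
    (hs : ∀ u, φ (s u) = 0) (hs' : ∀ u, φ (s' u) = 0) {θ θ' : Dual K U}
    (h : s + θ.smulRight w = s' + θ'.smulRight w) : s = s' ∧ θ = θ' := by
  have hθ : θ = θ' := by
    ext u
    have := congrArg φ (LinearMap.congr_fun h u)
    simpa [hs, hs', hφw] using this
  subst hθ
  exact ⟨add_right_cancel h, rfl⟩

/-- Two subspaces of dimension `r`, both in large position with respect to a chain, the second one
avoiding a vector of the first, exist as soon as the last member of the chain is large. -/
theorem exists_not_le_of_lt_finrank [FiniteDimensional K U] {r : ℕ} (hr : 1 ≤ r)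
    (G : ℕ → Submodule K U) (hmono : ∀ i j, i ≤ j → j ≤ r → G i ≤ G j)
    (hG : ∀ i ≤ r, i ≤ finrank K (G i)) (hlt : r < finrank K (G r)) {M : Submodule K U}
    (hM : finrank K M = r) :
    ∃ M' : Submodule K U, ¬ M ≤ M' ∧ ∀ i ≤ r, i ≤ finrank K ↥(M' ⊓ G i) := by
  obtain ⟨N, hNG, hN, hNi⟩ := exists_finrank_eq_forall_le_finrank_inf (r := r - 1) G
    (fun i j hij hj => hmono i j hij (by omega)) (fun i hi => hG i (by omega))
  have hNr : N ≤ G r := hNG.trans (hmono _ _ (by omega) le_rfl)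
  -- `N` has dimension `r - 1` and already meets the conditions below `r`. The vector `x` completes
  -- it to dimension `r` and is chosen so that the result differs from `M`.
  obtain ⟨x, hx, hxN, hxM⟩ : ∃ x ∈ G r, x ∉ N ∧ (N ≤ M → x ∉ M) := by
    by_cases h : N ≤ M
    · have : ¬ G r ≤ M := fun h' => by
        have := Submodule.finrank_mono h'
        omega
      obtain ⟨x, hx, hxM⟩ := SetLike.not_le_iff_exists.1 this
      exact ⟨x, hx, fun h' => hxM (h h'), fun _ => hxM⟩
    · have : ¬ G r ≤ N := fun h' => by
        have := Submodule.finrank_mono h'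
        omega
      obtain ⟨x, hx, hxN⟩ := SetLike.not_le_iff_exists.1 this
      exact ⟨x, hx, hxN, fun h' => (h h').elim⟩
  have hxs : x ∈ N ⊔ Submodule.span K {x} :=
    Submodule.mem_sup_right (Submodule.mem_span_singleton_self x)
  have hsG : N ⊔ Submodule.span K {x} ≤ G r :=
    sup_le hNr ((Submodule.span_singleton_le_iff_mem _ _).2 hx)
  have hge : r ≤ finrank K ↥(N ⊔ Submodule.span K {x}) := by
    have : N < N ⊔ Submodule.span K {x} :=
      lt_of_le_of_ne le_sup_left fun h => hxN (h ▸ hxs)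
    have := Submodule.finrank_lt_finrank_of_lt this
    omega
  have hle : finrank K ↥(N ⊔ Submodule.span K {x}) ≤ r := by
    have h1 := Submodule.finrank_add_le_finrank_add_finrank N (Submodule.span K {x})
    have h2 := finrank_span_singleton (K := K) (v := x) fun h => hxN (h ▸ N.zero_mem)
    omega
  refine ⟨N ⊔ Submodule.span K {x}, fun h => ?_, fun i hi => ?_⟩
  · have := Submodule.eq_of_le_of_finrank_le h (by omega)
    rw [this] at hxM
    exact hxM le_sup_left hxs
  · rcases Nat.lt_or_ge i r with h | h
    · exact (hNi i (by omega)).trans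
        (Submodule.finrank_mono (inf_le_inf_right _ le_sup_left))
    · obtain rfl : i = r := le_antisymm hi h
      rwa [inf_eq_left.2 hsG]

/-- Choose for each section `s` into the hyperplane `X ∩ ker φ` an `r`-dimensional witness `M s` of
the conditions. The `q ^ (dim U - r)` functionals `θ` killing `M s` give sections `s + θ ⊗ w` into
`X`, all distinct because `φ` recovers `θ`. If `s⁻¹(A_r)` has dimension above `r`, the witness is
not forced, and another choice yields a section outside this family. -/
theorem pow_mul_card_sections_le [Finite K] [FiniteDimensional K U] [FiniteDimensional K V]
    (π : V →ₗ[K] U) (A : ℕ → Submodule K V) {r : ℕ}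
    (hA : ∀ i j, i ≤ j → j ≤ r → A i ≤ A j)
    {X : Submodule K V} {φ : V →ₗ[K] K} {w : V} (hφw : φ w = 1) (hw : w ∈ X) (hπ : π w = 0) :
    Nat.card K ^ (finrank K U - r) * Nat.card (sections π A r (X ⊓ LinearMap.ker φ)) ≤
        Nat.card (sections π A r X) ∧
      (1 ≤ r → (∃ s ∈ sections π A r (X ⊓ LinearMap.ker φ), r < finrank K ((A r).comap s)) →
        Nat.card K ^ (finrank K U - r) * Nat.card (sections π A r (X ⊓ LinearMap.ker φ)) <
          Nat.card (sections π A r X)) := by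
  classical
  have hfin : Finite (U →ₗ[K] V) := Module.finite_of_finite K
  have hfin' : Finite (Dual K U) := Module.finite_of_finite K
  have hmono : ∀ s : U →ₗ[K] V, ∀ i j, i ≤ j → j ≤ r → (A i).comap s ≤ (A j).comap s :=
    fun s i j hij hj => Submodule.comap_mono (hA i j hij hj)
  have hex : ∀ s : sections π A r (X ⊓ LinearMap.ker φ), ∃ M : Submodule K U,
      finrank K M = r ∧ ∀ i ≤ r, i ≤ finrank K ↥(M ⊓ (A i).comap s.1) := fun s => by
    obtain ⟨M, -, h1, h2⟩ := exists_finrank_eq_forall_le_finrank_inf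
      (fun i => (A i).comap s.1) (hmono s.1) s.2.2.2
    exact ⟨M, h1, h2⟩
  choose M hMr hM using hex
  have hker : ∀ s : sections π A r (X ⊓ LinearMap.ker φ), ∀ u, φ (s.1 u) = 0 :=
    fun s u => (s.2.1 u).2
  let F : (Σ s : sections π A r (X ⊓ LinearMap.ker φ), (M s).dualAnnihilator) →
      sections π A r X := fun p => ⟨p.1.1 + (p.2.1 : Dual K U).smulRight w,
        add_smulRight_mem_sections inf_le_left p.1.2 hw hπ
          ((Submodule.mem_dualAnnihilator _).1 p.2.2) (hM p.1)⟩
  have hF : Function.Injective F := by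
    rintro ⟨s, θ⟩ ⟨s', θ'⟩ h
    obtain ⟨h1, h2⟩ := add_smulRight_inj hφw (hker s) (hker s') (congrArg Subtype.val h)
    obtain rfl := Subtype.ext h1
    obtain rfl := Subtype.ext h2
    rfl
  have hcard : Nat.card (Σ s : sections π A r (X ⊓ LinearMap.ker φ), (M s).dualAnnihilator) =
      Nat.card K ^ (finrank K U - r) * Nat.card (sections π A r (X ⊓ LinearMap.ker φ)) := by
    have : Fintype (sections π A r (X ⊓ LinearMap.ker φ)) := Fintype.ofFinite _
    rw [Nat.card_sigma, Finset.sum_congr rfl (g := fun _ => Nat.card K ^ (finrank K U - r))]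
    · simp [mul_comm]
    · intro s _
      rw [Module.natCard_eq_pow_finrank (K := K)]
      congr 1
      have := Subspace.finrank_add_finrank_dualAnnihilator_eq (M s)
      have := hMr s
      omega
  rw [← hcard]
  refine ⟨Nat.card_le_card_of_injective F hF, ?_⟩
  rintro hr ⟨s, hs, hlt⟩
  obtain ⟨M', hM'M, hM'⟩ := exists_not_le_of_lt_finrank hr (fun i => (A i).comap s) (hmono s)
    hs.2.2 hlt (hMr ⟨s, hs⟩)
  obtain ⟨y, hy, hyM'⟩ := SetLike.not_le_iff_exists.1 hM'M
  -- `θ` vanishes on the new witness `M'` but not at `y ∈ M s`, so `s + θ ⊗ w` is a section missed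
  -- by `F`.
  obtain ⟨θ, hθy, hθ⟩ := Submodule.exists_dual_map_eq_bot_of_notMem hyM' inferInstance
  have hθ' : ∀ x ∈ M', θ x = 0 := fun x hx => by
    have : θ x ∈ M'.map θ := ⟨x, hx, rfl⟩
    rwa [hθ] at this
  have hmem := add_smulRight_mem_sections inf_le_left hs hw hπ hθ' hM'
  have := Fintype.ofFinite (sections π A r X)
  have := Fintype.ofFinite
    (Σ s : sections π A r (X ⊓ LinearMap.ker φ), (M s).dualAnnihilator)
  rw [Nat.card_eq_fintype_card, Nat.card_eq_fintype_card]
  refine Fintype.card_lt_of_injective_of_notMem F hF (b := ⟨_, hmem⟩) ?_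
  rintro ⟨⟨s', θ'⟩, h⟩
  obtain ⟨h1, h2⟩ := add_smulRight_inj hφw (hker s') (hker ⟨s, hs⟩) (congrArg Subtype.val h)
  obtain rfl : s' = ⟨s, hs⟩ := Subtype.ext h1
  apply hθy
  rw [← h2]
  exact (Submodule.mem_dualAnnihilator _).1 θ'.2 y hy

/-- Choose `r + 1` independent vectors greedily in the images of `A 1, …, A r, A r`, lift each to
the corresponding `A i`, and extend to a section. Repeating `A r`, by means of `min`, provides the
extra dimension. -/
theorem exists_mem_sections_lt_finrank_comap [FiniteDimensional K U] (π : V →ₗ[K] U)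
    (A : ℕ → Submodule K V) {r : ℕ}
    (hA : ∀ i j, i ≤ j → j ≤ r → A i ≤ A j) {X : Submodule K V} (hAX : ∀ i ≤ r, A i ≤ X)
    (hX : X.map π = ⊤) (hπA : ∀ i ≤ r, i ≤ finrank K ((A i).map π))
    (hlt : r < finrank K ((A r).map π)) :
    ∃ s ∈ sections π A r X, r < finrank K ((A r).comap s) := by
  obtain ⟨u, hu, huA⟩ := exists_linearIndependent_forall_mem
    (fun i : Fin (r + 1) => (A (min (i + 1) r)).map π) (fun i => by
      rcases Nat.lt_or_ge i r with h | h
      · rw [min_eq_left h]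
        exact hπA _ h
      · rw [min_eq_right (by omega)]
        omega)
  choose a haA hau using huA
  obtain ⟨s, hsX, hsπ, hsa⟩ := exists_section_apply_eq π hX hu
    (fun i => hAX _ (min_le_right _ _) (haA i)) hau
  refine ⟨s, ⟨hsX, hsπ, fun i hi => ?_⟩, ?_⟩
  · refine le_finrank_of_linearIndependent_mem hu (by omega) fun j hj => ?_
    rw [Submodule.mem_comap, hsa]
    exact hA _ _ (by omega) hi (haA j)
  · refine Nat.lt_of_succ_le (le_finrank_of_linearIndependent_mem hu le_rfl fun j hj => ?_)
    rw [Submodule.mem_comap, hsa]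
    exact hA _ _ (by omega) le_rfl (haA j)

/-- The number of sections of `π` compatible with a flag is at least the expected power of the
cardinality of the field, and larger when the image of the flag in `U` jumps too early. -/
theorem pow_le_card_sections [Finite K] [FiniteDimensional K U] [FiniteDimensional K V]
    (π : V →ₗ[K] U) (A : ℕ → Submodule K V) (hA0 : A 0 = ⊥) (n : ℕ) :
    ∀ (r : ℕ) (X : Submodule K V), finrank K X + r = n → r ≤ finrank K U →
      (∀ i j, i < j → j ≤ r → A i < A j) → (∀ i ≤ r, A i ≤ X) → X.map π = ⊤ →
      (∀ i ≤ r, i ≤ finrank K ((A i).map π)) →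
      finrank K (A r) + (finrank K U - r) ≤ finrank K X →
      Nat.card K ^ (∑ i ∈ Finset.range (r + 1), (finrank K (A i) - i) +
          (finrank K U - r) * (finrank K X - finrank K U)) ≤ Nat.card (sections π A r X) ∧
        ∀ p ≤ r, p < finrank K ((A p).map π) →
          (p < r → finrank K (A p) + 2 ≤ finrank K (A (p + 1))) →
          (p = r → finrank K (A r) + (finrank K U - r) < finrank K X) →
          Nat.card K ^ (∑ i ∈ Finset.range (r + 1), (finrank K (A i) - i) +
            (finrank K U - r) * (finrank K X - finrank K U)) < Nat.card (sections π A r X) := by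
  induction n using Nat.strong_induction_on with
  | _ n ih =>
  intro r X hn hr hA hAX hX hπA hdim
  have hA' : ∀ i j, i ≤ j → j ≤ r → A i ≤ A j := fun i j hij hj => by
    rcases hij.eq_or_lt with rfl | h
    · exact le_rfl
    · exact (hA i j h hj).le
  have hrA : r ≤ finrank K (A r) := (hπA r le_rfl).trans (Submodule.finrank_map_le π (A r))
  have hfin : Finite (U →ₗ[K] V) := Module.finite_of_finite K
  -- With equality the condition at `r` is automatic and is dropped; otherwise there is room for a
  -- hyperplane of `X` containing `A r`.
  rcases hdim.eq_or_lt with hdim | hdim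
  · rcases Nat.eq_zero_or_pos r with rfl | hr0
    · have h0 : finrank K (A 0) = 0 := by rw [hA0, finrank_bot]
      constructor
      · have hU : finrank K X - finrank K U = 0 := by omega
        have he : ∑ i ∈ Finset.range (0 + 1), (finrank K (A i) - i) +
            (finrank K U - 0) * (finrank K X - finrank K U) = 0 := by simp [h0, hU]
        rw [he, pow_zero]
        obtain ⟨s, h1, h2, -⟩ := exists_section_apply_eq π hX
          (linearIndependent_empty_type : LinearIndependent K (Fin.elim0 : Fin 0 → U))
          (a := Fin.elim0) (fun i => i.elim0) (fun i => i.elim0)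
        have : Nonempty (sections π A 0 X) := ⟨⟨s, h1, h2, fun i hi => by omega⟩⟩
        exact Nat.card_pos
      · intro p hp hlt
        obtain rfl : p = 0 := by omega
        rw [hA0, Submodule.map_bot, finrank_bot] at hlt
        exact (lt_irrefl _ hlt).elim
    · obtain ⟨r, rfl⟩ : ∃ k, r = k + 1 := ⟨r - 1, by omega⟩
      have hlt : finrank K (A r) < finrank K (A (r + 1)) :=
        Submodule.finrank_lt_finrank_of_lt (hA _ _ (by omega) le_rfl)
      -- The image of `s` and `A (r + 1)` both lie in `X`, so by the dimension formula they meet in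
      -- dimension at least `dim U + dim A (r + 1) - dim X = r + 1`.
      have hsub : sections π A r X ⊆ sections π A (r + 1) X := fun s hs => by
        refine ⟨hs.1, hs.2.1, fun i hi => ?_⟩
        rcases hi.eq_or_lt with rfl | hi
        · have hinj := injective_of_comp_eq_id hs.2.1
          rw [finrank_comap_eq_finrank_inf_range hinj]
          have h1 := Submodule.finrank_sup_add_finrank_inf_eq (LinearMap.range s) (A (r + 1))
          have h2 : LinearMap.range s ⊔ A (r + 1) ≤ X := by
            refine sup_le ?_ (hAX _ le_rfl)
            rintro _ ⟨u, rfl⟩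
            exact hs.1 u
          have h3 := Submodule.finrank_mono h2
          have h4 := LinearMap.finrank_range_of_inj hinj
          omega
        · exact hs.2.2 i (by omega)
      have hle : Nat.card (sections π A r X) ≤ Nat.card (sections π A (r + 1) X) :=
        Nat.card_mono (Set.toFinite _) hsub
      obtain ⟨h1, h2⟩ := ih (finrank K X + r) (by omega) r X rfl (by omega)
        (fun i j hij hj => hA i j hij (by omega)) (fun i hi => hAX i (by omega)) hX
        (fun i hi => hπA i (by omega)) (by omega)
      have he : ∑ i ∈ Finset.range (r + 1 + 1), (finrank K (A i) - i) +
            (finrank K U - (r + 1)) * (finrank K X - finrank K U) =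
          ∑ i ∈ Finset.range (r + 1), (finrank K (A i) - i) +
            (finrank K U - r) * (finrank K X - finrank K U) := by
        rw [Finset.sum_range_succ]
        have e1 : finrank K (A (r + 1)) - (r + 1) = finrank K X - finrank K U := by omega
        have e2 : finrank K U - r = finrank K U - (r + 1) + 1 := by omega
        rw [e1, e2]
        ring
      rw [he]
      refine ⟨h1.trans hle, fun p hp hlt hj hj' => lt_of_lt_of_le
        (h2 p ?_ hlt (fun h => hj (by omega)) fun h => ?_) hle⟩
      -- The case `p = r + 1` is excluded, since the slack it assumes contradicts equality. If `p =
      -- r`, the jump `dim A r + 2 ≤ dim A (r + 1)` is exactly what leaves slack after the drop.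
      · by_contra hcon
        have := hj' (by omega)
        omega
      · subst h
        have := hj (by omega)
        omega
  -- Otherwise `ker π ∩ X ≤ A r`, whence `dim X - dim U ≤ dim A r - dim π(A r) ≤ dim A r - r`,
  -- against the strict inequality.
  · obtain ⟨w, ⟨hπw, hwX⟩, hwA⟩ : ∃ w ∈ LinearMap.ker π ⊓ X, w ∉ A r := by
      refine SetLike.not_le_iff_exists.1 fun h => ?_
      have h1 := finrank_inf_ker_add_finrank_map π X
      have h2 := finrank_inf_ker_add_finrank_map π (A r)
      have h3 := Submodule.finrank_mono (le_inf inf_le_left h :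
        LinearMap.ker π ⊓ X ≤ LinearMap.ker π ⊓ A r)
      have h4 := hπA r le_rfl
      rw [hX, finrank_top] at h1
      omega
    replace hπw : π w = 0 := hπw
    obtain ⟨φ, hφw, hφA⟩ : ∃ φ : V →ₗ[K] K, φ w = 1 ∧ A r ≤ LinearMap.ker φ := by
      obtain ⟨φ, h1, h2⟩ := Submodule.exists_dual_map_eq_bot_of_notMem hwA inferInstance
      refine ⟨(φ w)⁻¹ • φ, by simp [h1], fun x hx => ?_⟩
      have : φ x ∈ (A r).map φ := ⟨x, hx, rfl⟩
      rw [h2, Submodule.mem_bot] at this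
      simp [this]
    have hAY : ∀ i ≤ r, A i ≤ X ⊓ LinearMap.ker φ := fun i hi =>
      le_inf (hAX i hi) ((hA' i r hi le_rfl).trans hφA)
    have hY : (X ⊓ LinearMap.ker φ).map π = ⊤ := by
      rw [eq_top_iff]
      rintro u -
      obtain ⟨v, hv, rfl⟩ : u ∈ X.map π := hX ▸ Submodule.mem_top
      exact ⟨v - φ v • w, ⟨X.sub_mem hv (X.smul_mem _ hwX), by simp [hφw]⟩, by simp [hπw]⟩
    have hYdim := finrank_inf_ker_add_one hwX hφw
    obtain ⟨h1, h2⟩ := ih (finrank K ↥(X ⊓ LinearMap.ker φ) + r) (by omega) r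
      (X ⊓ LinearMap.ker φ) rfl hr hA hAY hY hπA (by omega)
    obtain ⟨h3, h4⟩ := pow_mul_card_sections_le π A hA' hφw hwX hπw
    have he : ∑ i ∈ Finset.range (r + 1), (finrank K (A i) - i) +
          (finrank K U - r) * (finrank K X - finrank K U) =
        (finrank K U - r) + (∑ i ∈ Finset.range (r + 1), (finrank K (A i) - i) +
          (finrank K U - r) * (finrank K ↥(X ⊓ LinearMap.ker φ) - finrank K U)) := by
      have e : finrank K X - finrank K U =
          finrank K ↥(X ⊓ LinearMap.ker φ) - finrank K U + 1 := by omega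
      rw [e]
      ring
    have hq : 0 < Nat.card K ^ (finrank K U - r) := pow_pos Nat.card_pos _
    rw [he, pow_add]
    refine ⟨(Nat.mul_le_mul_left _ h1).trans h3, fun p hp hlt hj hj' => ?_⟩
    rcases hp.eq_or_lt with rfl | hpr
    · refine (Nat.mul_le_mul_left _ h1).trans_lt (h4 ?_
        (exists_mem_sections_lt_finrank_comap π A hA' hAY hY hπA hlt))
      by_contra hcon
      obtain rfl : p = 0 := by omega
      rw [hA0, Submodule.map_bot, finrank_bot] at hlt
      exact lt_irrefl _ hlt
    · exact (Nat.mul_lt_mul_of_pos_left (h2 p hp hlt hj fun h => by omega) hq).trans_le h3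

end Sections

/-! ### A projection with few compatible sections: the upper bound -/

section GenericProjection

variable {K V : Type*} [Field K] [AddCommGroup V] [Module K V]

/-- A map to `K^l` sending the `i`-th member of a flag onto the first `i` coordinates. -/
theorem exists_linearMap_flag [FiniteDimensional K V] (A : ℕ → Submodule K V) (l : ℕ)
    (hA : ∀ i j, i < j → j ≤ l → A i < A j) :
    ∃ π : V →ₗ[K] (Fin l → K), (∀ i ≤ l, ∀ x ∈ A i, ∀ j : Fin l, i ≤ j → π x j = 0) ∧
      ∀ i ≤ l, i ≤ finrank K ((A i).map π) := by
  -- The coordinate `φ j` kills `A j` but not `A (j + 1)`, so the images of the chain grow strictly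
  -- and stay in coordinate subspaces.
  have h : ∀ j : Fin l, ∃ φ : V →ₗ[K] K, (∀ x ∈ A j, φ x = 0) ∧ ∃ y ∈ A (j + 1), φ y ≠ 0 := by
    intro j
    obtain ⟨y, hy, hyA⟩ := SetLike.exists_of_lt (hA j (j + 1) (by omega) (by omega))
    obtain ⟨φ, h1, h2⟩ := Submodule.exists_dual_map_eq_bot_of_notMem hyA inferInstance
    refine ⟨φ, fun x hx => ?_, y, hy, h1⟩
    have : φ x ∈ (A j).map φ := ⟨x, hx, rfl⟩
    rwa [h2, Submodule.mem_bot] at this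
  choose φ hφ y hy hφy using h
  have hzero : ∀ i ≤ l, ∀ x ∈ A i, ∀ j : Fin l, i ≤ j → LinearMap.pi φ x j = 0 := by
    intro i hi x hx j hij
    rw [LinearMap.pi_apply]
    refine hφ j x ?_
    rcases hij.eq_or_lt with rfl | hlt
    · exact hx
    · exact (hA i j hlt j.2.le).le hx
  refine ⟨LinearMap.pi φ, hzero, fun i => ?_⟩
  induction i with
  | zero => exact fun _ => Nat.zero_le _
  | succ i ih =>
    intro hi
    have hlt : (A i).map (LinearMap.pi φ) < (A (i + 1)).map (LinearMap.pi φ) := by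
      refine lt_of_le_of_ne (Submodule.map_mono (hA i (i + 1) (by omega) hi).le) fun heq => ?_
      have hmem : LinearMap.pi φ (y ⟨i, hi⟩) ∈ (A (i + 1)).map (LinearMap.pi φ) :=
        ⟨_, hy ⟨i, hi⟩, rfl⟩
      rw [← heq] at hmem
      obtain ⟨x, hx, hxy⟩ := hmem
      apply hφy ⟨i, hi⟩
      have h1 := hzero i (by omega) x hx ⟨i, hi⟩ le_rfl
      rwa [hxy] at h1
    have := Submodule.finrank_lt_finrank_of_lt hlt
    have := ih (by omega)
    omega

/-- As `π ∘ s = id`, the space `s⁻¹(A (j + 1))` lies in the span of the first `j + 1` basis vectors,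
and the incidence condition makes them equal. So `s` sends the basis vector `e_j` into `A (j + 1) ∩
π⁻¹(e_j)`, which is empty or a coset of `ker π ∩ A (j + 1)`, and these values determine `s`. -/
theorem card_sections_le [Finite K] [FiniteDimensional K V] (A : ℕ → Submodule K V)
    (hA0 : A 0 = ⊥) {l : ℕ} {π : V →ₗ[K] (Fin l → K)}
    (hzero : ∀ i ≤ l, ∀ x ∈ A i, ∀ j : Fin l, i ≤ j → π x j = 0)
    (hπA : ∀ i ≤ l, i ≤ finrank K ((A i).map π)) :
    Nat.card (sections π A l ⊤) ≤
      Nat.card K ^ (∑ i ∈ Finset.range (l + 1), (finrank K (A i) - i)) := by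
  classical
  have hfinV : Finite V := Module.finite_of_finite K
  have hmem : ∀ s ∈ sections π A l ⊤, ∀ j : Fin l, s (Pi.single j 1) ∈ A (j + 1) := by
    rintro s ⟨-, hs, hsA⟩ j
    let E : Submodule K (Fin l → K) := Submodule.span K
      (Set.range fun k : Fin (j + 1) => Pi.single (Fin.castLE j.2 k) (1 : K))
    have hE : finrank K E ≤ j + 1 := by
      have := finrank_range_le_card (R := K)
        (fun k : Fin (j + 1) => (Pi.single (Fin.castLE j.2 k) (1 : K) : Fin l → K))
      rwa [Fintype.card_fin] at this
    have hle : (A (j + 1)).comap s ≤ E := fun x hx => by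
      have hx' : π (s x) = x := LinearMap.congr_fun hs x
      rw [pi_eq_sum_univ' x]
      refine E.sum_mem fun k _ => ?_
      by_cases hk : (k : ℕ) < j + 1
      · exact E.smul_mem _ (Submodule.subset_span ⟨⟨k, hk⟩, by
          ext i
          simp [Pi.single_apply, Fin.ext_iff, eq_comm]⟩)
      · have := hzero (j + 1) j.2 (s x) hx k (by omega)
        rw [hx'] at this
        rw [this, zero_smul]
        exact E.zero_mem
    have heq := Submodule.eq_of_le_of_finrank_le hle (hE.trans (hsA _ j.2))
    have : (Pi.single j 1 : Fin l → K) ∈ E := Submodule.subset_span ⟨Fin.last _, rfl⟩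
    rwa [← heq] at this
  let F : sections π A l ⊤ → ∀ j : Fin l, {a : V // a ∈ A (j + 1) ∧ π a = Pi.single j 1} :=
    fun s j => ⟨s.1 (Pi.single j 1), hmem s.1 s.2 j, LinearMap.congr_fun s.2.2.1 _⟩
  have hF : Function.Injective F := fun s s' h => by
    refine Subtype.ext ((Pi.basisFun K (Fin l)).ext fun j => ?_)
    rw [Pi.basisFun_apply]
    exact congrArg Subtype.val (congrFun h j)
  have hfib : ∀ j : Fin l, Nat.card {a : V // a ∈ A (j + 1) ∧ π a = Pi.single j 1} ≤
      Nat.card K ^ (finrank K (A (j + 1)) - (j + 1)) := by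
    intro j
    rcases isEmpty_or_nonempty {a : V // a ∈ A (j + 1) ∧ π a = Pi.single j 1} with h | ⟨⟨a₀, ha₀⟩⟩
    · simp
    · let T : {a : V // a ∈ A (j + 1) ∧ π a = Pi.single j 1} →
          ↥(LinearMap.ker π ⊓ A (j + 1)) := fun a =>
        ⟨a.1 - a₀, by simp [a.2.2, ha₀.2], (A (j + 1)).sub_mem a.2.1 ha₀.1⟩
      have hT : Function.Injective T := fun a a' h =>
        Subtype.ext (sub_left_injective (congrArg Subtype.val h))
      refine (Nat.card_le_card_of_injective T hT).trans ?_
      rw [Module.natCard_eq_pow_finrank (K := K)]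
      refine Nat.pow_le_pow_right Nat.card_pos ?_
      have h1 := finrank_inf_ker_add_finrank_map π (A (j + 1))
      have h2 := hπA (j + 1) j.2
      omega
  refine (Nat.card_le_card_of_injective F hF).trans ?_
  rw [Nat.card_pi, Finset.sum_range_succ', hA0, finrank_bot, Finset.sum_range, Nat.sub_zero, add_zero,
    ← Finset.prod_pow_eq_pow_sum]
  exact Finset.prod_le_prod' fun j _ => hfib j

end GenericProjection

/-! ### Decomposable elements and their annihilators -/

section Decomposable

variable {K V : Type*} [Field K] [AddCommGroup V] [Module K V]

theorem ιMulti_ne_zero_iff {d : ℕ} {v : Fin d → V} :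
    ExteriorAlgebra.ιMulti K d v ≠ 0 ↔ LinearIndependent K v := by
  refine ⟨fun h => ?_, fun h h0 => ?_⟩
  · by_contra hv
    exact h ((ExteriorAlgebra.ιMulti K d).map_linearDependent v hv)
  -- Pulling back the determinant along a map that sends `v` to the standard basis gives an
  -- alternating form with value `1` at `v`.
  · obtain ⟨g, hg⟩ : ∃ g : V →ₗ[K] (Fin d → K), ∀ i, g (v i) = Pi.basisFun K (Fin d) i := by
      have hr := h.linearIndepOn_id
      let B := Basis.extend hr
      obtain ⟨p, hp⟩ := LinearMap.exists_extend (h.repr : _ →ₗ[K] (Fin d →₀ K))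
      refine ⟨(Finsupp.linearEquivFunOnFinite K K (Fin d)).toLinearMap ∘ₗ p, fun i => ?_⟩
      have h1 := LinearMap.congr_fun hp ⟨v i, Submodule.subset_span ⟨i, rfl⟩⟩
      have h2 : p (v i) = Finsupp.single i 1 := h1.trans (h.repr_eq_single i _ rfl)
      rw [LinearMap.comp_apply, h2]
      simp
    have h1 := exteriorPower.alternatingMapLinearEquiv_apply_ιMulti
      ((Pi.basisFun K (Fin d)).det.compLinearMap g) v
    have h2 : exteriorPower.ιMulti K d v = 0 := Subtype.ext h0
    rw [h2, map_zero, AlternatingMap.compLinearMap_apply] at h1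
    have h3 : (fun i => g (v i)) = Pi.basisFun K (Fin d) := funext hg
    change 0 = (Pi.basisFun K (Fin d)).det fun i => g (v i) at h1
    rw [h3, Basis.det_self] at h1
    exact zero_ne_one h1

theorem annihilator_ιMulti {d : ℕ} {v : Fin d → V} (hv : LinearIndependent K v) :
    annihilator (exteriorPower.ιMulti K d v) = Submodule.span K (Set.range v) := by
  ext x
  have h1 : ExteriorAlgebra.ιMulti K d v * ExteriorAlgebra.ι K x =
      ExteriorAlgebra.ιMulti K (d + 1) (Fin.snoc (α := fun _ => V) v x) := by
    have h2 : ExteriorAlgebra.ι K x = ExteriorAlgebra.ιMulti K 1 ![x] := by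
      simp [ExteriorAlgebra.ιMulti_apply]
    rw [h2, ExteriorAlgebra.ιMulti_mul_ιMulti, Fin.append_right_eq_snoc]
    simp
  have h3 : x ∈ annihilator (exteriorPower.ιMulti K d v) ↔
      ExteriorAlgebra.ιMulti K d v * ExteriorAlgebra.ι K x = 0 := Iff.rfl
  rw [h3, h1, ← not_iff_not, ← ne_eq, ιMulti_ne_zero_iff, linearIndependent_finSnoc]
  exact and_iff_right hv

theorem topIdent_wedge_ne_zero_iff {p r m : ℕ} (b : Basis (Fin m) K V) (h : p + r = m)
    {v : Fin p → V} (hv : LinearIndependent K v) {u : Fin r → V} (hu : LinearIndependent K u) :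
    topIdent b (wedge h (exteriorPower.ιMulti K p v) (exteriorPower.ιMulti K r u)) ≠ 0 ↔
      Disjoint (Submodule.span K (Set.range v)) (Submodule.span K (Set.range u)) := by
  subst h
  have h1 : wedge rfl (exteriorPower.ιMulti K p v) (exteriorPower.ιMulti K r u) =
      exteriorPower.ιMulti K (p + r) (Fin.append v u) :=
    Subtype.ext (ExteriorAlgebra.ιMulti_mul_ιMulti ..)
  rw [h1, topIdent, exteriorPower.alternatingMapLinearEquiv_apply_ιMulti, ← isUnit_iff_ne_zero,
    ← Basis.is_basis_iff_det]
  have h2 : LinearIndependent K (Fin.append v u) ↔ LinearIndependent K (Sum.elim v u) := by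
    rw [← linearIndependent_equiv finSumFinEquiv]
    congr! 1
    ext i
    rcases i with i | i <;> simp
  have := b.finiteDimensional_of_finite
  refine ⟨fun h => ?_, fun h => ?_⟩
  · exact (linearIndependent_sum.1 (h2.1 h.1)).2.2
  · have h3 := h2.2 (hv.sum_type hu h)
    exact ⟨h3, h3.span_eq_top_of_card_eq_finrank' (by rw [finrank_eq_card_basis b])⟩

theorem IsDecomposable.exists_eq {d : ℕ} {f : ⋀[K]^d V} (hf : IsDecomposable f) :
    ∃ v : Fin d → V, LinearIndependent K v ∧ f = exteriorPower.ιMulti K d v ∧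
      annihilator f = Submodule.span K (Set.range v) := by
  obtain ⟨h0, v, rfl⟩ := hf
  have hv : LinearIndependent K v := ιMulti_ne_zero_iff.1 fun h => h0 (Subtype.ext h)
  exact ⟨v, hv, rfl, annihilator_ιMulti hv⟩

theorem IsDecomposable.finrank_annihilator {d : ℕ} {f : ⋀[K]^d V} (hf : IsDecomposable f) :
    finrank K (annihilator f) = d := by
  obtain ⟨v, hv, -, h⟩ := hf.exists_eq
  rw [h, finrank_span_eq_card hv, Fintype.card_fin]

theorem IsDecomposable.topIdent_wedge_ne_zero_iff {p r m : ℕ} (b : Basis (Fin m) K V)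
    (h : p + r = m) {f : ⋀[K]^p V} (hf : IsDecomposable f) {g : ⋀[K]^r V}
    (hg : IsDecomposable g) :
    topIdent b (wedge h f g) ≠ 0 ↔ Disjoint (annihilator f) (annihilator g) := by
  obtain ⟨v, hv, hfv, hf'⟩ := hf.exists_eq
  obtain ⟨u, hu, hgu, hg'⟩ := hg.exists_eq
  rw [hf', hg', hfv, hgu]
  exact SchubertCode.topIdent_wedge_ne_zero_iff b h hv hu

theorem exists_isDecomposable_annihilator_eq [FiniteDimensional K V] (W : Submodule K V) {d : ℕ}
    (hW : finrank K W = d) : ∃ f : ⋀[K]^d V, IsDecomposable f ∧ annihilator f = W := by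
  let B := finBasisOfFinrankEq K W hW
  have hv : LinearIndependent K fun i => (B i : V) :=
    B.linearIndependent.map' W.subtype (Submodule.ker_subtype W)
  refine ⟨exteriorPower.ιMulti K d fun i => (B i : V), ⟨fun h => ?_, _, rfl⟩, ?_⟩
  · exact ιMulti_ne_zero_iff.2 hv (congrArg Subtype.val h)
  · rw [annihilator_ιMulti hv]
    have : Set.range (fun i => (B i : V)) = W.subtype '' Set.range B := by
      rw [← Set.range_comp]
      rfl
    rw [this, ← Submodule.map_span, B.span_eq, Submodule.map_subtype_top]

end Decomposable

/-! ### Codeword weights as numbers of sections -/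

section Weights

variable {K V : Type*} [Field K] [AddCommGroup V] [Module K V]

/-- The flag `0 ⊂ A₁ ⊂ ⋯ ⊂ A_l`, indexed by natural numbers. -/
def extendFlag {l : ℕ} (A : Fin l → Submodule K V) : ℕ → Submodule K V
  | 0 => ⊥
  -- Only indices up to `l` matter; `⊤` is a filler value.
  | i + 1 => if h : i < l then A ⟨i, h⟩ else ⊤

theorem extendFlag_zero {l : ℕ} (A : Fin l → Submodule K V) : extendFlag A 0 = ⊥ := rfl

theorem extendFlag_succ {l : ℕ} (A : Fin l → Submodule K V) (i : Fin l) :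
    extendFlag A (i + 1) = A i :=
  dif_pos i.2

theorem extendFlag_lt {l : ℕ} {A : Fin l → Submodule K V} (hA : StrictMono A)
    (hA0 : ∀ i, A i ≠ ⊥) (i j : ℕ) (hij : i < j) (hj : j ≤ l) :
    extendFlag A i < extendFlag A j := by
  obtain ⟨j, rfl⟩ : ∃ k, j = k + 1 := ⟨j - 1, by omega⟩
  rw [extendFlag_succ A ⟨j, hj⟩]
  rcases i with _ | i
  · exact bot_lt_iff_ne_bot.2 (hA0 _)
  · rw [extendFlag_succ A ⟨i, by omega⟩]
    exact hA (Nat.lt_of_succ_lt_succ hij)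

/-- The points of a Schubert variety disjoint from the kernel of a linear map onto a space of
dimension `l` are the images of the compatible sections. -/
theorem card_disjoint_eq_card_sections [FiniteDimensional K V] {U : Type*} [AddCommGroup U]
    [Module K U] [FiniteDimensional K U] {l : ℕ} (A : Fin l → Submodule K V) (π : V →ₗ[K] U)
    (hU : finrank K U = l) :
    Nat.card {L : schubertVariety A // Disjoint (LinearMap.ker π) (L : Submodule K V)} =
      Nat.card (sections π (extendFlag A) l ⊤) := by
  symm
  have hdisj : ∀ s : U →ₗ[K] V, π ∘ₗ s = LinearMap.id →
      Disjoint (LinearMap.ker π) (LinearMap.range s) := by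
    intro s hs
    rw [Submodule.disjoint_def]
    rintro _ hx ⟨u, rfl⟩
    have : π (s u) = u := LinearMap.congr_fun hs u
    rw [LinearMap.mem_ker, this] at hx
    rw [hx, map_zero]
  refine Nat.card_congr (Equiv.ofBijective (fun s => ⟨⟨LinearMap.range s.1, ?_, fun i => ?_⟩,
    hdisj s.1 s.2.2.1⟩) ⟨?_, ?_⟩)
  · rw [LinearMap.finrank_range_of_inj (injective_of_comp_eq_id s.2.2.1), hU]
  · have := s.2.2.2 (i + 1) i.2
    rwa [extendFlag_succ, finrank_comap_eq_finrank_inf_range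
      (injective_of_comp_eq_id s.2.2.1)] at this
  · intro s s' h
    have hr : LinearMap.range s.1 = LinearMap.range s'.1 :=
      congrArg Subtype.val (congrArg Subtype.val h)
    refine Subtype.ext (LinearMap.ext fun u => ?_)
    obtain ⟨u', hu'⟩ : s.1 u ∈ LinearMap.range s'.1 := hr ▸ ⟨u, rfl⟩
    have h1 : π (s.1 u) = u := LinearMap.congr_fun s.2.2.1 u
    have h2 : π (s'.1 u') = u' := LinearMap.congr_fun s'.2.2.1 u'
    rw [hu', h1] at h2
    rw [← hu', h2]
  · rintro ⟨⟨L, hL, hLA⟩, hd⟩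
    have hinj : Function.Injective (π.domRestrict L) := by
      rw [← LinearMap.ker_eq_bot, eq_bot_iff]
      intro x hx
      exact Subtype.ext (Submodule.disjoint_def.1 hd _ hx x.2)
    -- Disjointness from the kernel makes `π` an isomorphism from `L` to `U`; its inverse is the
    -- section with image `L`.
    let e := LinearEquiv.ofInjectiveOfFinrankEq (π.domRestrict L) hinj (by rw [hL, hU])
    have he : ∀ x, e x = π x := fun x => rfl
    have hs : π ∘ₗ (L.subtype ∘ₗ e.symm.toLinearMap) = LinearMap.id := by
      ext u
      have := he (e.symm u)
      rw [e.apply_symm_apply] at this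
      exact this.symm
    have hrange : LinearMap.range (L.subtype ∘ₗ e.symm.toLinearMap) = L := by
      rw [LinearMap.range_comp_of_range_eq_top _ e.symm.range, Submodule.range_subtype]
    refine ⟨⟨L.subtype ∘ₗ e.symm.toLinearMap, fun _ => Submodule.mem_top, hs, fun i hi => ?_⟩,
      Subtype.ext (Subtype.ext hrange)⟩
    rw [finrank_comap_eq_finrank_inf_range (injective_of_comp_eq_id hs), hrange]
    rcases i with _ | i
    · exact Nat.zero_le _
    · rw [extendFlag_succ A ⟨i, hi⟩]
      exact hLA ⟨i, hi⟩

/-- The case `r = l = dim U`, `X = ⊤` of the general bound, where the term with factor `dim U - r`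
disappears. -/
theorem pow_le_card_sections_extendFlag [Finite K] [FiniteDimensional K V] {U : Type*}
    [AddCommGroup U] [Module K U] [FiniteDimensional K U] {l : ℕ} {A : Fin l → Submodule K V}
    (hA : StrictMono A) (hA0 : ∀ i, A i ≠ ⊥) (π : V →ₗ[K] U) (hU : finrank K U = l)
    (hπ : LinearMap.range π = ⊤) (hπA : ∀ i ≤ l, i ≤ finrank K ((extendFlag A i).map π)) :
    Nat.card K ^ (∑ i ∈ Finset.range (l + 1), (finrank K (extendFlag A i) - i)) ≤
        Nat.card (sections π (extendFlag A) l ⊤) ∧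
      ∀ p < l, p < finrank K ((extendFlag A p).map π) →
        finrank K (extendFlag A p) + 2 ≤ finrank K (extendFlag A (p + 1)) →
        Nat.card K ^ (∑ i ∈ Finset.range (l + 1), (finrank K (extendFlag A i) - i)) <
          Nat.card (sections π (extendFlag A) l ⊤) := by
  obtain ⟨h1, h2⟩ := pow_le_card_sections π (extendFlag A) (extendFlag_zero A) _ l ⊤ rfl hU.ge
    (extendFlag_lt hA hA0) (fun _ _ => le_top) (by rw [Submodule.map_top, hπ]) hπA
    (by rw [hU, Nat.sub_self, add_zero]; exact Submodule.finrank_mono le_top)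
  rw [hU, Nat.sub_self, zero_mul, add_zero] at h1 h2
  exact ⟨h1, fun p hp hlt hj => h2 p hp.le hlt (fun _ => hj) fun h => (hp.ne h).elim⟩

theorem weight_eq_card {n : ℕ} (c : Fin n → K) : weight c = Nat.card {j // c j ≠ 0} := by
  classical
  rw [Nat.card_eq_fintype_card, Fintype.card_subtype]
  unfold weight hammingNorm
  congr!

theorem IsRepresentative.isDecomposable {l : ℕ} {A : Fin l → Submodule K V} {L : Submodule K V}
    {P : ⋀[K]^l V} (h : IsRepresentative A L P) : IsDecomposable P :=
  have ⟨v, _, hv⟩ := h.2.1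
  ⟨h.1, fun i => v i.rev, hv⟩

theorem weight_codeword {l m n : ℕ} (hlm : l ≤ m) (b : Basis (Fin m) K V)
    {A : Fin l → Submodule K V} (L : Fin n ≃ schubertVariety A) {P : Fin n → ⋀[K]^l V}
    (hP : ∀ j, IsRepresentative A (L j : Submodule K V) (P j)) {f : ⋀[K]^(m - l) V}
    (hf : IsDecomposable f) :
    weight (codeword b hlm P f) =
      Nat.card {L : schubertVariety A // Disjoint (annihilator f) (L : Submodule K V)} := by
  rw [weight_eq_card]
  refine Nat.card_congr (L.subtypeEquiv fun j => ?_)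
  rw [← (hP j).2.2]
  exact hf.topIdent_wedge_ne_zero_iff b (Nat.sub_add_cancel hlm) (hP j).isDecomposable

theorem weight_pos_iff {n : ℕ} {c : Fin n → K} : 0 < weight c ↔ c ≠ 0 := by
  classical
  unfold weight
  exact hammingNorm_pos_iff

end Weights

end SchubertCode

/-! ### Comparison of the two bounds -/

theorem theorem5p5
    {K V : Type*} [Field K] [Finite K] [AddCommGroup V] [Module K V]
    {l m : ℕ} (hl : 1 ≤ l) (hlm : l < m)
    (b : Module.Basis (Fin m) K V)
    (A : Fin l → Submodule K V) (hA : StrictMono A) (hA0 : ∀ i, A i ≠ ⊥)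
    {n : ℕ} (L : Fin n ≃ SchubertCode.schubertVariety A)
    (P : Fin n → ⋀[K]^l V)
    (hP : ∀ j, SchubertCode.IsRepresentative A (L j : Submodule K V) (P j))
    (f : ⋀[K]^(m - l) V) (hf : SchubertCode.IsDecomposable f)
    (hmin : SchubertCode.IsMinWeightCodeword
      (SchubertCode.schubertCode b hlm.le P) (SchubertCode.codeword b hlm.le P f)) :
    SchubertCode.IsSchubertDecomposable A f := by
  open SchubertCode Module in
  have hfd : FiniteDimensional K V := b.finiteDimensional_of_finite
  have hm : finrank K V = m := by rw [finrank_eq_card_basis b, Fintype.card_fin]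
  have hflag := extendFlag_lt hA hA0
  have hsmall : 0 < weight (codeword b hlm.le P f) ∧ weight (codeword b hlm.le P f) ≤
      Nat.card K ^ (∑ i ∈ Finset.range (l + 1), (finrank K (extendFlag A i) - i)) := by
    obtain ⟨π, hzero, hπA⟩ := exists_linearMap_flag (extendFlag A) l hflag
    have hrange : LinearMap.range π = ⊤ := by
      refine Submodule.eq_top_of_finrank_eq (le_antisymm (Submodule.finrank_le _) ?_)
      rw [finrank_fin_fun]
      exact (hπA l le_rfl).trans (Submodule.finrank_mono (LinearMap.map_le_range))
    have hker : finrank K (LinearMap.ker π) = m - l := by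
      have := LinearMap.finrank_range_add_finrank_ker π
      rw [hrange, finrank_top, finrank_fin_fun] at this
      omega
    obtain ⟨g, hg, hgker⟩ := exists_isDecomposable_annihilator_eq _ hker
    have hwt : weight (codeword b hlm.le P g) =
        Nat.card (sections π (extendFlag A) l ⊤) := by
      rw [weight_codeword hlm.le b L hP hg, hgker,
        card_disjoint_eq_card_sections A π (finrank_fin_fun K)]
    have hpos : 0 < weight (codeword b hlm.le P g) := by
      rw [hwt]
      exact (pow_pos Nat.card_pos _).trans_le
        (pow_le_card_sections_extendFlag hA hA0 π (finrank_fin_fun K) hrange hπA).1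
    -- This makes the set of nonzero weights nonempty, so its `sInf` is attained by a nonzero word
    -- and is not the default value `0`.
    have hmemg : weight (codeword b hlm.le P g) ∈
        {w | ∃ c ∈ schubertCode b hlm.le P, c ≠ 0 ∧ weight c = w} :=
      ⟨_, ⟨g, rfl⟩, weight_pos_iff.1 hpos, rfl⟩
    rw [hmin.2]
    constructor
    · obtain ⟨c, -, hc, hcw⟩ := Nat.sInf_mem ⟨_, hmemg⟩
      exact (weight_pos_iff.2 hc).trans_eq hcw
    · refine (Nat.sInf_le hmemg).trans ?_
      rw [hwt]
      exact card_sections_le (extendFlag A) (extendFlag_zero A) hzero hπA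
  refine ⟨hf, fun i hi => ?_⟩
  obtain ⟨hil, hi⟩ := hi
  have hU : finrank K (V ⧸ annihilator f) = l := by
    have := Submodule.finrank_quotient_add_finrank (annihilator f)
    rw [hf.finrank_annihilator] at this
    omega
  have hwt : weight (codeword b hlm.le P f) =
      Nat.card (sections (annihilator f).mkQ (extendFlag A) l ⊤) := by
    rw [weight_codeword hlm.le b L hP hf, ← card_disjoint_eq_card_sections A _ hU,
      Submodule.ker_mkQ]
  rw [hwt] at hsmall
  -- Positive weight provides a section `s`, and `s⁻¹(A_i)` is contained in `π(A_i)`.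
  have hπA : ∀ i ≤ l, i ≤ finrank K ((extendFlag A i).map (annihilator f).mkQ) := by
    intro i hi
    obtain ⟨⟨s, -, hs, hsA⟩⟩ := (Nat.card_pos_iff.1 hsmall.1).1
    exact (hsA i hi).trans (Submodule.finrank_mono fun u hu =>
      ⟨s u, hu, LinearMap.congr_fun hs u⟩)
  -- An image of dimension above `i + 1` at this jump spot would push the weight strictly above the
  -- upper bound.
  have hnot := fun hlt hj => (((pow_le_card_sections_extendFlag hA hA0 _ hU
    (Submodule.range_mkQ _) hπA).2 (i + 1) hil hlt hj).trans_le hsmall.2).false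
  rw [extendFlag_succ A i] at hnot
  have hge := hπA (i + 1) i.2
  rw [extendFlag_succ A i] at hge
  have hsum := finrank_inf_ker_add_finrank_map (annihilator f).mkQ (A i)
  rw [Submodule.ker_mkQ] at hsum
  have hle : finrank K ((A i).map (annihilator f).mkQ) ≤ i + 1 := by
    by_contra hcon
    refine hnot (not_le.1 hcon) ?_
    rw [extendFlag_succ A ⟨i + 1, hil⟩]
    exact hi
  unfold dimSeq
  omega
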